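/- Let $\mathbb T=\mathbb R/\mathbb Z$ be the circle group with its usual topology, let $\mathfrak c=|\mathbb R|$, and let $\mathbb T^{\mathfrak c}$ carry the product topology. A subset $E$ of an abelian group $G$ (written additively) is called almost $0$-torsion in $G$ if $E$ is countably infinite and, for every $g\in G$ and every integer $d\ge 1$, the set $\{x\in E: dx=g\}$ is finite. For a subset $S$ of an abelian group $G$, the following conditions are equivalent: (i) there exists a group homomorphism $\pi:G\to\mathbb T^{\mathfrak c}$ such that $\pi(S)$ is dense in $\mathbb T^{\mathfrak c}$; (ii) $S$ contains an almost $0$-torsion set (that is, some subset $E\subseteq S$ is almost $0$-torsion in $G$). Furthermore, if $|G|\le 2^{\mathfrak c}$, then (i) and (ii) are also equivalent to (iii) there exists an injective group homomorphism $\pi:G\to\mathbb T^{\mathfrak c}$ such that $\pi(S)$ is dense in $\mathbb T^{\mathfrak c}$. -/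

import Mathlib

/-- `d` is a proper divisor of `n`: `d ∣ n` and `d ∉ {0, n}`. In particular every positive natural
number is a proper divisor of `0`. (Note that `Nat.properDivisors 0 = ∅`, which is a different
convention.) -/
def IsProperDivisor (d n : ℕ) : Prop :=
  d ≠ 0 ∧ d ≠ n ∧ d ∣ n

/-- A subset `S` of an abelian group `G` is almost `n`-torsion in `G` if it is countably infinite,
is contained in `G[n] = {x | n x = 0}`, and `{x ∈ S | d x = g}` is finite for every `g ∈ G` and
every proper divisor `d` of `n`. -/
def IsAlmostTorsion {G : Type*} [AddCommGroup G] (n : ℕ) (S : Set G) : Prop :=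
  S.Countable ∧ S.Infinite ∧ (∀ x ∈ S, n • x = 0) ∧
    ∀ (g : G) (d : ℕ), IsProperDivisor d n → {x ∈ S | d • x = g}.Finite

/-! Necessity: one coordinate of `π` gives a character `χ` with `χ(S)` dense in the circle. There `d
u = v` has finitely many solutions, so points of `S` can be chosen recursively to avoid all
coincidences `d x = d y` with earlier points, for `d` up to a growing bound.

Sufficiency: `E` lies in a countable subgroup `H`. By `exists_small_hom_near`, for each finite `F ⊆
H` some `x ∈ E` takes almost arbitrary values under characters almost trivial on `F`: either `x` has
large order modulo `⟨F⟩`, or a real functional unbounded on `E` can be rescaled. Summably small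
perturbations of this kind, aimed at a sequence that approximates all points of the power, converge
to a homomorphism with dense image of `E` (`exists_hom_dense_image`). Divisibility of the circle
extends it to `G`.

Injectivity: `|G| ≤ 2^𝔠` gives an embedding `j` into the power (`exists_injective_hom_pi`). Starting
the perturbations from copies of `j`, with ever later copies disturbed ever less, keeps the limit
injective on `H`; doubling the coordinates then handles `G`. -/

open Function Filter Topology

/-! ### Extension into divisible groups -/

/-- A homomorphism into a power of the circle extends along any injective homomorphism. -/
theorem exists_extension_pi_addCircle {M N A : Type*} [AddCommGroup M] [AddCommGroup N]
    (f : M →+ N) (hf : Injective f) (g : M →+ (A → UnitAddCircle)) :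
    ∃ h : N →+ (A → UnitAddCircle), ∀ x, h (f x) = g x := by
  have key (a : A) : ∃ h : N →+ UnitAddCircle, h.comp f = (Pi.evalAddMonoidHom _ a).comp g :=
    (Module.Baer.of_divisible _).extension_property_addMonoidHom f hf _
  choose h hh using key
  refine ⟨AddMonoidHom.pi h, fun x ↦ funext fun a ↦ ?_⟩
  exact DFunLike.congr_fun (hh a) x

theorem exists_extension_addCircle {M N : Type*} [AddCommGroup M] [AddCommGroup N]
    (f : M →+ N) (hf : Injective f) (g : M →+ UnitAddCircle) :
    ∃ h : N →+ UnitAddCircle, ∀ x, h (f x) = g x := by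
  obtain ⟨h, hh⟩ := (Module.Baer.of_divisible UnitAddCircle).extension_property_addMonoidHom f hf g
  exact ⟨h, DFunLike.congr_fun hh⟩

theorem exists_extension_real {M N : Type*} [AddCommGroup M] [AddCommGroup N]
    (f : M →+ N) (hf : Injective f) (g : M →+ ℝ) :
    ∃ h : N →+ ℝ, ∀ x, h (f x) = g x := by
  let _ : DivisibleBy ℝ ℤ := divisibleByIntOfCharZero
  obtain ⟨h, hh⟩ := (Module.Baer.of_divisible ℝ).extension_property_addMonoidHom f hf g
  exact ⟨h, DFunLike.congr_fun hh⟩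

/-! ### Embedding groups into powers of the circle -/

/-- Sums of the coordinates of `x` whose label meets `F` in `Q`. -/
theorem exists_injective_finsupp_to_pi {I ι M : Type*} [AddCommGroup M] (s : I → Set ι)
    (hs : Injective s) :
    ∃ φ : (I →₀ M) →+ (Finset ι × Finset ι → M), Injective φ := by
  classical
  refine ⟨Finsupp.liftAddHom fun i ↦ AddMonoidHom.pi fun P : Finset ι × Finset ι ↦
    if (∀ a ∈ P.1, a ∈ s i ↔ a ∈ P.2) then AddMonoidHom.id M else 0, ?_⟩
  rw [injective_iff_map_eq_zero]
  intro x hx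
  by_contra hne
  obtain ⟨i₀, hi₀⟩ := Finsupp.support_nonempty_iff.2 hne
  have sep (i : {i // i ≠ i₀}) : ∃ a : ι, ¬ (a ∈ s i ↔ a ∈ s i₀) := by
    by_contra! hc
    exact i.2 (hs (Set.ext hc))
  choose a ha using sep
  -- `F` separates `i₀` from the rest of the support, so the coordinate `(F, F ∩ s i₀)` sees only
  -- the term at `i₀`.
  set F : Finset ι := (x.support.subtype (· ≠ i₀)).image a with hF
  have hval := congrFun hx (F, F.filter (· ∈ s i₀))
  simp only [Finsupp.liftAddHom_apply, Finsupp.sum, Finset.sum_apply, AddMonoidHom.pi_apply,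
    Pi.zero_apply] at hval
  rw [Finset.sum_eq_single_of_mem i₀ hi₀] at hval
  · rw [if_pos] at hval
    · exact (Finsupp.mem_support_iff.1 hi₀) hval
    · intro b hb
      simp [hb]
  · intro i hi hne'
    rw [if_neg, AddMonoidHom.zero_apply]
    intro hall
    have hmem : a ⟨i, hne'⟩ ∈ F := by
      rw [hF, Finset.mem_image]
      exact ⟨⟨i, hne'⟩, by simpa using hi, rfl⟩
    apply ha ⟨i, hne'⟩
    rw [hall _ hmem]
    simp [hmem]

/-- Over a domain that is a quotient of `ℤ` and embeds in the circle, a module with at most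
`2 ^ #ι` elements has `#(Finset ι × Finset ι)` characters separating non-torsion points. -/
theorem exists_hom_pi_of_smul_ne_zero {R V ι : Type*} [CommRing R] [IsDomain R] [AddCommGroup V]
    [Module R V] (hR : Surjective (Int.cast : ℤ → R)) (θ : R →+ UnitAddCircle) (hθ : Injective θ)
    (s : V → Set ι) (hs : Injective s) :
    ∃ σ : V →+ (Finset ι × Finset ι → UnitAddCircle), ∀ v, σ v = 0 → ∃ r : R, r ≠ 0 ∧ r • v = 0 := by
  obtain ⟨I, hI, hmax⟩ := exists_maximal_linearIndepOn R (id : V → V)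
  obtain ⟨φ, hφ⟩ := exists_injective_finsupp_to_pi (M := UnitAddCircle) (fun i : I ↦ s i)
    (hs.comp Subtype.val_injective)
  set f : (I →₀ R) →+ V := (Finsupp.linearCombination R (fun i : I ↦ (i : V))).toAddMonoidHom with hf
  have hfinj : Injective f := hI
  set θ' : (I →₀ R) →+ (I →₀ UnitAddCircle) := Finsupp.mapRange.addMonoidHom θ
  have hθ' : Injective θ' := Finsupp.mapRange_injective _ (map_zero θ) hθ
  obtain ⟨σ, hσ⟩ := exists_extension_pi_addCircle f hfinj (φ.comp θ')
  refine ⟨σ, fun v hv ↦ ?_⟩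
  have hspan : ∃ r : R, r ≠ 0 ∧ r • v ∈ Submodule.span R (id '' I) := by
    by_cases hvI : v ∈ I
    · exact ⟨1, one_ne_zero, by simpa using Submodule.subset_span hvI⟩
    · exact hmax v hvI
  obtain ⟨r, hr, hmem⟩ := hspan
  refine ⟨r, hr, ?_⟩
  -- `σ` is only additive; it commutes with the scalar because that scalar comes from an integer.
  obtain ⟨n, rfl⟩ := hR r
  rw [Set.image_id, ← Subtype.range_coe (s := I), Finsupp.mem_span_range_iff_exists_finsupp] at hmem
  obtain ⟨c, hc⟩ := hmem
  have hfc : f c = (n : R) • v := hc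
  have h0 : σ (f c) = 0 := by
    rw [hfc, Int.cast_smul_eq_zsmul, map_zsmul, hv, smul_zero]
  rw [hσ] at h0
  have : c = 0 := (injective_iff_map_eq_zero _).1 (show Injective (φ.comp θ') from hφ.comp hθ') c h0
  rw [← hfc, this, map_zero]

theorem exists_injective_int_addCircle : ∃ θ : ℤ →+ UnitAddCircle, Injective θ := by
  refine ⟨zmultiplesHom _ ((√2 : ℝ) : UnitAddCircle), ?_⟩
  rw [injective_iff_map_eq_zero]
  intro n hn
  rw [zmultiplesHom_apply, ← AddCircle.coe_zsmul, AddCircle.coe_eq_zero_iff] at hn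
  obtain ⟨m, hm⟩ := hn
  by_contra hne
  refine irrational_sqrt_two ⟨m / n, ?_⟩
  have : (n : ℝ) ≠ 0 := by exact_mod_cast hne
  push_cast
  rw [div_eq_iff this]
  simpa [mul_comm] using hm

/-- An abelian group with at most `2 ^ #ι` elements has `#ι` characters separating points, for
infinite `ι`. -/
theorem exists_injective_hom_pi {G ι : Type*} [AddCommGroup G] (s : G → Set ι) (hs : Injective s) :
    ∃ φ : G →+ (ℕ × (Finset ι × Finset ι) → UnitAddCircle), Injective φ := by
  -- Index `0` detects elements of infinite order; a prime index `p` detects the `p`-torsion.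
  have key (p : ℕ) : ∃ σ : G →+ (Finset ι × Finset ι → UnitAddCircle),
      (p = 0 → ∀ v, σ v = 0 → ∃ n : ℤ, n ≠ 0 ∧ n • v = 0) ∧
      (p.Prime → ∀ v, p • v = 0 → σ v = 0 → v = 0) := by
    rcases eq_or_ne p 0 with rfl | hp0
    · obtain ⟨θ, hθ⟩ := exists_injective_int_addCircle
      obtain ⟨σ, hσ⟩ := exists_hom_pi_of_smul_ne_zero (R := ℤ) (fun n ↦ ⟨n, by simp⟩) θ hθ s hs
      exact ⟨σ, fun _ ↦ hσ, fun h ↦ absurd h Nat.not_prime_zero⟩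
    by_cases hp : p.Prime
    · have : Fact p.Prime := ⟨hp⟩
      let _ : Module (ZMod p) (AddSubgroup.torsionBy G (p : ℤ)) := AddSubgroup.torsionBy.zmodModule
      obtain ⟨σ, hσ⟩ := exists_hom_pi_of_smul_ne_zero (R := ZMod p) (ZMod.intCast_surjective)
        ZMod.toAddCircle (ZMod.toAddCircle_injective p)
        (fun v : AddSubgroup.torsionBy G (p : ℤ) ↦ s v) (hs.comp Subtype.val_injective)
      obtain ⟨τ, hτ⟩ := exists_extension_pi_addCircle (AddSubgroup.torsionBy G (p : ℤ)).subtype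
        Subtype.val_injective σ
      refine ⟨τ, fun h ↦ absurd h hp0, fun _ v hv h0 ↦ ?_⟩
      have hmem : v ∈ AddSubgroup.torsionBy G (p : ℤ) := AddSubgroup.torsionBy.nsmul_iff.2 hv
      obtain ⟨r, hr, hr0⟩ := hσ ⟨v, hmem⟩ (by rw [← hτ]; exact h0)
      have := (smul_eq_zero.1 hr0).resolve_left hr
      exact congrArg Subtype.val this
    · exact ⟨0, fun h ↦ absurd h hp0, fun h ↦ absurd h hp⟩
  choose σ hσ0 hσp using key
  refine ⟨AddMonoidHom.pi fun q ↦ (Pi.evalAddMonoidHom _ q.2).comp (σ q.1), ?_⟩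
  rw [injective_iff_map_eq_zero]
  intro v hv
  have hv' (p : ℕ) : σ p v = 0 := funext fun q ↦ congrFun hv (p, q)
  obtain ⟨n, hn, hnv⟩ := hσ0 0 rfl v (hv' 0)
  have hfin : addOrderOf v ≠ 0 := by
    rw [ne_eq, addOrderOf_eq_zero_iff', not_forall]
    refine ⟨n.natAbs, fun h ↦ h (Int.natAbs_pos.2 hn) ?_⟩
    rcases Int.natAbs_eq n with h | h <;> rw [h] at hnv <;> simpa using hnv
  by_contra hne
  have h1 : addOrderOf v ≠ 1 := by rwa [ne_eq, AddMonoid.addOrderOf_eq_one_iff]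
  obtain ⟨p, hp, k, hk⟩ := Nat.exists_prime_and_dvd h1
  have hkv : k • v = 0 := by
    refine hσp p hp _ ?_ (by rw [map_nsmul, hv', smul_zero])
    rw [← mul_nsmul', ← hk, addOrderOf_nsmul_eq_zero]
  have hdvd := addOrderOf_dvd_of_nsmul_eq_zero hkv
  have hk0 : 0 < k := Nat.pos_of_ne_zero fun h ↦ hfin (by rw [hk, h, mul_zero])
  have := Nat.le_of_dvd hk0 hdvd
  rw [hk] at this
  nlinarith [hp.two_le]

/-! ### Characters small on a finite set and prescribed at a point -/

theorem UnitAddCircle.norm_coe_le_abs (x : ℝ) : ‖(x : UnitAddCircle)‖ ≤ |x| := by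
  rw [UnitAddCircle.norm_eq]
  simpa using round_le x 0

/-- `n`-torsion points are `1 / N`-dense in the circle for `n ≥ N`; all points are torsion for
`n = 0`. -/
theorem exists_nsmul_eq_zero_norm_sub_le {n N : ℕ} (hN : 0 < N) (hn : n = 0 ∨ N ≤ n)
    (t : UnitAddCircle) : ∃ s : UnitAddCircle, n • s = 0 ∧ ‖s - t‖ ≤ 1 / N := by
  rcases hn with rfl | hn
  · exact ⟨t, zero_smul _ _, by simp⟩
  obtain ⟨r, rfl⟩ := QuotientAddGroup.mk_surjective t
  have hn0 : (0 : ℝ) < n := by exact_mod_cast hN.trans_le hn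
  refine ⟨((round (r * n) / n : ℝ) : UnitAddCircle), ?_, ?_⟩
  · rw [← AddCircle.coe_nsmul, AddCircle.coe_eq_zero_iff]
    refine ⟨round (r * n), ?_⟩
    rw [nsmul_eq_mul, mul_div_cancel₀ _ hn0.ne']
    simp
  · refine (UnitAddCircle.norm_coe_le_abs (round (r * n) / n - r)).trans ?_
    have h1 : (round (r * n) / n - r : ℝ) = (round (r * n) - r * n) / n := by
      field_simp
    rw [h1, abs_div, abs_of_pos hn0, abs_sub_comm]
    have h2 : |r * n - round (r * n)| ≤ 1 := (abs_sub_round _).trans (by norm_num)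
    have h3 : (N : ℝ) ≤ n := by exact_mod_cast hn
    have h4 : (0 : ℝ) < N := by exact_mod_cast hN
    gcongr

/-- If `x` has order at least `N` modulo `K`, then some character vanishing on `K` takes at `x` a
value `1 / N`-close to a given one. -/
theorem exists_hom_vanishing_near {H : Type*} [AddCommGroup H] (K : AddSubgroup H) (x : H) {N : ℕ}
    (hN : 0 < N) (hx : ∀ n, 0 < n → n < N → n • x ∉ K) (t : UnitAddCircle) :
    ∃ ψ : H →+ UnitAddCircle, (∀ h ∈ K, ψ h = 0) ∧ ‖ψ x - t‖ ≤ 1 / N := by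
  set q : H ⧸ K := QuotientAddGroup.mk x with hq
  have hord : addOrderOf q = 0 ∨ N ≤ addOrderOf q := by
    by_contra! h
    refine hx _ (Nat.pos_of_ne_zero h.1) h.2 ?_
    rw [← QuotientAddGroup.eq_zero_iff, QuotientAddGroup.mk_nsmul]
    exact addOrderOf_nsmul_eq_zero q
  obtain ⟨s, hs, hst⟩ := exists_nsmul_eq_zero_norm_sub_le hN hord t
  -- Since `ZMod 0 = ℤ`, finite and infinite order are treated together.
  set f : ZMod (addOrderOf q) →+ H ⧸ K := ZMod.lift _ ⟨zmultiplesHom _ q, by simp⟩ with hf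
  set g : ZMod (addOrderOf q) →+ UnitAddCircle := ZMod.lift _ ⟨zmultiplesHom _ s, by simpa⟩ with hg
  have hfinj : Injective f := by
    rw [hf, ZMod.lift_injective]
    intro m hm
    rw [ZMod.intCast_zmod_eq_zero_iff_dvd]
    exact addOrderOf_dvd_iff_zsmul_eq_zero.2 hm
  obtain ⟨h, hh⟩ := exists_extension_addCircle f hfinj g
  have hf1 : f ((1 : ℤ) : ZMod (addOrderOf q)) = q := by rw [hf, ZMod.lift_coe]; simp
  have hg1 : g ((1 : ℤ) : ZMod (addOrderOf q)) = s := by rw [hg, ZMod.lift_coe]; simp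
  refine ⟨h.comp (QuotientAddGroup.mk' K), fun k hk ↦ ?_, ?_⟩
  · have : QuotientAddGroup.mk' K k = 0 := (QuotientAddGroup.eq_zero_iff k).2 hk
    rw [AddMonoidHom.comp_apply, this, map_zero]
  · rw [AddMonoidHom.comp_apply]
    change ‖h q - t‖ ≤ _
    rwa [← hf1, hh, hg1]

/-- A finitely generated abelian group has finitely many integer functionals that are jointly
proper. -/
theorem exists_functionals_finite_bounded (A : Type*) [AddCommGroup A] [AddGroup.FG A] :
    ∃ (n : ℕ) (l : Fin n → A →+ ℤ), ∀ C : ℤ, {a : A | ∀ i, |l i a| ≤ C}.Finite := by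
  classical
  obtain ⟨n, ι, _, p, hp, e, ⟨f⟩⟩ := AddCommGroup.equiv_free_prod_directSum_zmod A
  have (i : ι) : NeZero (p i ^ e i) := ⟨pow_ne_zero _ (hp i).ne_zero⟩
  have : Finite (DirectSum ι fun i ↦ ZMod (p i ^ e i)) :=
    Finite.of_equiv _ DFinsupp.equivFunOnFintype.symm
  refine ⟨n, fun i ↦ (Finsupp.applyAddHom i).comp ((AddMonoidHom.fst _ _).comp f.toAddMonoidHom),
    fun C ↦ ?_⟩
  have hfin : (Set.pi Set.univ fun _ : Fin n ↦ Set.Icc (-C) C).Finite :=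
    Set.Finite.pi fun _ ↦ Set.finite_Icc _ _
  have hfin' := (hfin.preimage (f := fun v : Fin n →₀ ℤ ↦ ⇑v) DFunLike.coe_injective.injOn).prod
    (Set.finite_univ (α := DirectSum ι fun i ↦ ZMod (p i ^ e i)))
  refine (hfin'.preimage f.injective.injOn).subset fun a ha ↦ ?_
  simp only [Set.mem_preimage, Set.mem_prod, Set.mem_univ, and_true, Set.mem_pi, Set.mem_Icc]
  exact fun i _ ↦ abs_le.1 (ha i)

/-- If multiplication by `m ≠ 0` is finite-to-one on the infinite set `E` and maps it into a
finitely generated subgroup, then some real functional is unbounded on `E`. -/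
theorem exists_real_functional_unbounded {H : Type*} [AddCommGroup H] {E : Set H}
    (hinf : E.Infinite) (K : AddSubgroup H) [AddGroup.FG K] {m : ℕ} (hm : m ≠ 0)
    (hfib : ∀ g : H, {x ∈ E | m • x = g}.Finite) (hEK : ∀ x ∈ E, m • x ∈ K) :
    ∃ l : H →+ ℝ, ∀ C : ℝ, ∃ x ∈ E, C < |l x| := by
  obtain ⟨n, l, hl⟩ := exists_functionals_finite_bounded K
  -- If all real functionals were bounded on `E`, so would be the extended `l i`; then `m • E` would
  -- be finite, and hence `E` by the finite fibres.
  by_contra! hcon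
  have key (i : Fin n) : ∃ C : ℝ, ∀ x (hx : x ∈ E), |(l i ⟨m • x, hEK x hx⟩ : ℝ)| ≤ C := by
    obtain ⟨L, hL⟩ := exists_extension_real K.subtype Subtype.val_injective
      ((Int.castAddHom ℝ).comp (l i))
    obtain ⟨C, hC⟩ := hcon L
    refine ⟨m * C, fun x hx ↦ ?_⟩
    have := hL ⟨m • x, hEK x hx⟩
    simp only [AddSubgroup.subtype_apply, map_nsmul, AddMonoidHom.comp_apply,
      Int.coe_castAddHom] at this
    rw [← this, nsmul_eq_mul, abs_mul, Nat.abs_cast]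
    gcongr
    exact hC x hx
  choose C hC using key
  obtain ⟨D, hD⟩ := (Set.finite_range C).bddAbove
  refine hinf (Set.Finite.of_finite_fibers (fun x ↦ m • x) ?_ fun g _ ↦ hfib g)
  refine ((hl ⌈D⌉).image Subtype.val).subset ?_
  rintro _ ⟨x, hx, rfl⟩
  refine ⟨⟨m • x, hEK x hx⟩, fun i ↦ ?_, rfl⟩
  have h1 : |(l i ⟨m • x, hEK x hx⟩ : ℝ)| ≤ ⌈D⌉ :=
    (hC i x hx).trans ((hD ⟨i, rfl⟩).trans (Int.le_ceil D))
  exact_mod_cast h1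

/-- Characters that are small on a given finite set take almost arbitrary values at a suitable
point of an infinite set on which all multiplications are finite-to-one. -/
theorem exists_small_hom_near {H : Type*} [AddCommGroup H] {E : Set H} (hinf : E.Infinite)
    (hfib : ∀ (g : H) (d : ℕ), d ≠ 0 → {x ∈ E | d • x = g}.Finite) (F : Finset H) {ε : ℝ}
    (hε : 0 < ε) :
    ∃ x ∈ E, ∀ t : UnitAddCircle, ∃ ψ : H →+ UnitAddCircle,
      (∀ h ∈ F, ‖ψ h‖ ≤ ε) ∧ ‖ψ x - t‖ ≤ ε := by
  set K := AddSubgroup.closure (F : Set H)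
  have : AddGroup.FG K := AddGroup.closure_finset_fg F
  obtain ⟨N, hN⟩ := exists_nat_one_div_lt hε
  by_cases hcase : ∃ x ∈ E, ∀ n, 0 < n → n < N + 1 → n • x ∉ K
  · obtain ⟨x, hx, hxK⟩ := hcase
    refine ⟨x, hx, fun t ↦ ?_⟩
    obtain ⟨ψ, hψ, hψt⟩ := exists_hom_vanishing_near K x N.succ_pos hxK t
    refine ⟨ψ, fun h hh ↦ ?_, hψt.trans (by exact_mod_cast hN.le)⟩
    rw [hψ h (AddSubgroup.subset_closure hh), norm_zero]
    exact hε.le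
  · push Not at hcase
    have hEK : ∀ x ∈ E, N.factorial • x ∈ K := by
      intro x hx
      obtain ⟨n, hn, hnN, hmem⟩ := hcase x hx
      obtain ⟨k, hk⟩ := Nat.dvd_factorial hn (Nat.lt_succ_iff.1 hnN)
      rw [hk, mul_nsmul]
      exact K.nsmul_mem hmem k
    obtain ⟨l, hl⟩ := exists_real_functional_unbounded hinf K N.factorial_ne_zero
      (fun g ↦ hfib g _ N.factorial_ne_zero) hEK
    obtain ⟨C, hC⟩ := (F.image fun h ↦ |l h|).bddAbove
    have hC' : ∀ h ∈ F, |l h| ≤ max C 0 := fun h hh ↦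
      (hC (Finset.mem_coe.2 (Finset.mem_image_of_mem _ hh))).trans (le_max_left _ _)
    -- This threshold makes `|r / l x * l h| ≤ ε` for `h ∈ F` and every `r ∈ [0, 1)`.
    obtain ⟨x, hx, hxl⟩ := hl (max C 0 / ε)
    have hpos : 0 < |l x| := lt_of_le_of_lt (by positivity) hxl
    have hne : l x ≠ 0 := abs_pos.1 hpos
    refine ⟨x, hx, fun t ↦ ?_⟩
    set r : ℝ := (AddCircle.equivIco (1 : ℝ) 0 t : ℝ)
    have hr : r ∈ Set.Ico (0 : ℝ) (0 + 1) := (AddCircle.equivIco (1 : ℝ) 0 t).2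
    have hrt : (r : UnitAddCircle) = t := AddCircle.coe_equivIco
    refine ⟨(QuotientAddGroup.mk' _).comp ((AddMonoidHom.mulLeft (r / l x)).comp l),
      fun h hh ↦ ?_, ?_⟩
    · refine (UnitAddCircle.norm_coe_le_abs (r / l x * l h)).trans ?_
      rw [abs_mul, abs_div, abs_of_nonneg hr.1]
      rw [div_lt_iff₀ hε] at hxl
      have h1 := hC' h hh
      rw [div_mul_eq_mul_div, div_le_iff₀ hpos]
      have h2 : r ≤ 1 := by linarith [hr.2]
      nlinarith [abs_nonneg (l h), hr.1]
    · have : ((QuotientAddGroup.mk' _).comp ((AddMonoidHom.mulLeft (r / l x)).comp l)) x = t := by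
        change ((r / l x * l x : ℝ) : UnitAddCircle) = t
        rw [div_mul_cancel₀ _ hne, hrt]
      rw [this, sub_self, norm_zero]
      exact hε.le

/-! ### Dense images of countable groups -/

/-- Powers of the circle with at most continuum many factors: a sequence that approximates every
point on every finite set of coordinates, arbitrarily late. -/
theorem exists_seq_approximating {A : Type*} (e : A → ℕ → Bool) (he : Injective e) :
    ∃ f : ℕ → A → UnitAddCircle, ∀ (t : A → UnitAddCircle) (s : Finset A) (ε : ℝ), 0 < ε →
      ∀ N, ∃ n ≥ N, ∀ a ∈ s, dist (f n a) (t a) < ε := by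
  classical
  -- There are countably many functions of `a` that depend only on the first `k` bits of `e a` and
  -- take values in a fixed dense sequence. Below, `Nat.unpair` makes each of them recur infinitely
  -- often.
  obtain ⟨g, hg⟩ := exists_surjective_nat (Σ k : ℕ, (Fin k → Bool) → ℕ)
  let D (c : Σ k : ℕ, (Fin k → Bool) → ℕ) (a : A) : UnitAddCircle :=
    TopologicalSpace.denseSeq UnitAddCircle (c.2 fun i ↦ e a i)
  refine ⟨fun n ↦ D (g n.unpair.1), fun t s ε hε N ↦ ?_⟩
  have hsep (a b : A) : ∃ d : ℕ, a ≠ b → e a d ≠ e b d := by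
    by_cases h : a = b
    · exact ⟨0, fun h' ↦ absurd h h'⟩
    · obtain ⟨d, hd⟩ := Function.ne_iff.1 (he.ne h)
      exact ⟨d, fun _ ↦ hd⟩
  choose d hd using hsep
  set k : ℕ := (s ×ˢ s).sup (fun q ↦ d q.1 q.2) + 1
  have hinj : Injective fun (a : s) (i : Fin k) ↦ e a i := by
    intro a b hab
    by_contra hne
    have hlt : d a b < k := Nat.lt_succ_of_le
      (Finset.le_sup (f := fun q : A × A ↦ d q.1 q.2) (Finset.mk_mem_product a.2 b.2))
    exact hd a b (fun h ↦ hne (Subtype.ext h)) (congrFun hab ⟨d a b, hlt⟩)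
  have happ (a : A) : ∃ n, dist (TopologicalSpace.denseSeq UnitAddCircle n) (t a) < ε := by
    obtain ⟨n, hn⟩ := (TopologicalSpace.denseRange_denseSeq UnitAddCircle).exists_dist_lt (t a) hε
    exact ⟨n, by rwa [dist_comm]⟩
  choose u hu using happ
  obtain ⟨c, hc⟩ := hg ⟨k, Function.extend (fun (a : s) (i : Fin k) ↦ e a i) (fun a ↦ u a) 0⟩
  refine ⟨Nat.pair c N, Nat.right_le_pair c N, fun a ha ↦ ?_⟩
  change dist (D (g (Nat.unpair (Nat.pair c N)).1) a) (t a) < ε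
  rw [Nat.unpair_pair, hc]
  change dist (TopologicalSpace.denseSeq UnitAddCircle
    (Function.extend (fun (a : s) (i : Fin k) ↦ e a i) (fun a ↦ u a) 0
      ((fun (a : s) (i : Fin k) ↦ e a i) ⟨a, ha⟩))) (t a) < ε
  rw [hinj.extend_apply (fun a : s ↦ u a) 0 ⟨a, ha⟩]
  exact hu a

theorem dense_pi_of_forall_finset {A : Type*} {D : Set (A → UnitAddCircle)}
    (h : ∀ (t : A → UnitAddCircle) (s : Finset A) (ε : ℝ), 0 < ε →
      ∃ y ∈ D, ∀ a ∈ s, dist (y a) (t a) < ε) : Dense D := by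
  classical
  rw [dense_iff_inter_open]
  rintro U hU ⟨t, ht⟩
  obtain ⟨s, u, hu, hsub⟩ := isOpen_pi_iff.1 hU t ht
  have hball (a : A) : ∃ ε : ℝ, 0 < ε ∧ (a ∈ s → Metric.ball (t a) ε ⊆ u a) := by
    by_cases ha : a ∈ s
    · obtain ⟨ε, hε, hb⟩ := Metric.isOpen_iff.1 (hu a ha).1 _ (hu a ha).2
      exact ⟨ε, hε, fun _ ↦ hb⟩
    · exact ⟨1, one_pos, fun h ↦ absurd h ha⟩
  choose ε hε hb using hball
  obtain ⟨δ, hδ, hδs⟩ : ∃ δ : ℝ, 0 < δ ∧ ∀ a ∈ s, δ ≤ ε a := by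
    rcases s.eq_empty_or_nonempty with rfl | hs
    · exact ⟨1, one_pos, by simp⟩
    · refine ⟨s.inf' hs ε, (Finset.lt_inf'_iff hs).2 fun a _ ↦ hε a, fun a ha ↦ Finset.inf'_le ε ha⟩
  obtain ⟨y, hy, hys⟩ := h t s δ hδ
  exact ⟨y, hsub fun a ha ↦ hb a ha ((hys a ha).trans_le (hδs a ha)), hy⟩

/-- Perturb a homomorphism into a power of the circle on the coordinates in `J` only, slightly on
a finite set `F`, so that a prescribed point is almost attained on `J`. -/
theorem exists_perturbation {H A : Type*} [AddCommGroup H] {E : Set H} (hinf : E.Infinite)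
    (hfib : ∀ (g : H) (d : ℕ), d ≠ 0 → {x ∈ E | d • x = g}.Finite)
    (Φ : H →+ (A → UnitAddCircle)) (F : Finset H) {ε : ℝ} (hε : 0 < ε) (J : Set A)
    (f : A → UnitAddCircle) :
    ∃ Φ' : H →+ (A → UnitAddCircle), (∀ h ∈ F, ∀ a, dist (Φ h a) (Φ' h a) ≤ ε) ∧
      (∀ h, ∀ a ∉ J, Φ' h a = Φ h a) ∧ ∃ x ∈ E, ∀ a ∈ J, dist (Φ' x a) (f a) ≤ ε := by
  classical
  obtain ⟨x, hx, hψ⟩ := exists_small_hom_near hinf hfib F hε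
  choose ψ hF hx' using fun a ↦ hψ (f a - Φ x a)
  refine ⟨Φ + AddMonoidHom.pi fun a ↦ if a ∈ J then ψ a else 0, fun h hh a ↦ ?_,
    fun h a ha ↦ ?_, x, hx, fun a ha ↦ ?_⟩
  · by_cases ha : a ∈ J
    · simpa [ha, dist_eq_norm] using hF a h hh
    · simpa [ha] using hε.le
  · simp [ha]
  · rw [dist_eq_norm]
    have : (Φ + AddMonoidHom.pi fun a ↦ if a ∈ J then ψ a else 0) x a - f a
        = ψ a x - (f a - Φ x a) := by
      simp [ha]; abel
    rw [this]
    exact hx' a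

/-- A countable group `H` maps to `T ^ (B × ℕ)` with dense image of `E`, in such a way that every
point not killed by the `b`-th coordinate of a given homomorphism `j` to `T ^ B` is not killed by
some coordinate over `b`. -/
theorem exists_hom_dense_image {H B : Type*} [AddCommGroup H] [Countable H] {E : Set H}
    (hinf : E.Infinite) (hfib : ∀ (g : H) (d : ℕ), d ≠ 0 → {x ∈ E | d • x = g}.Finite)
    (e : B × ℕ → ℕ → Bool) (he : Injective e) (j : H →+ (B → UnitAddCircle)) :
    ∃ Φ : H →+ (B × ℕ → UnitAddCircle), Dense (Φ '' E) ∧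
      ∀ h b, j h b ≠ 0 → ∃ m, Φ h (b, m) ≠ 0 := by
  classical
  obtain ⟨f, hf⟩ := exists_seq_approximating e he
  obtain ⟨en, hen⟩ := exists_surjective_nat H
  let State := (H →+ (B × ℕ → UnitAddCircle)) × Finset H
  -- A state holds the current homomorphism and the finite set of elements to be nearly preserved.
  -- Stage `n` moves these by at most `2^-(n+1)`, so all moves from stage `n` on total at most
  -- `2^-n`; coordinates `(b, m)` with `m > n` are untouched.
  have step (n : ℕ) (S : State) : ∃ S' : State, S.2 ⊆ S'.2 ∧ en n ∈ S'.2 ∧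
      (∀ h ∈ S.2, ∀ a, dist (S.1 h a) (S'.1 h a) ≤ 1 / 2 / 2 ^ n) ∧
      (∀ h b m, n < m → S'.1 h (b, m) = S.1 h (b, m)) ∧
      ∃ x ∈ E, x ∈ S'.2 ∧ ∀ b m, m ≤ n → dist (S'.1 x (b, m)) (f n (b, m)) ≤ 1 / 2 / 2 ^ n := by
    obtain ⟨Φ', h1, h2, x, hx, h3⟩ := exists_perturbation hinf hfib S.1 S.2
      (show (0 : ℝ) < 1 / 2 / 2 ^ n by positivity) {a | a.2 ≤ n} (f n)
    refine ⟨(Φ', insert x (insert (en n) S.2)), ?_, by simp, h1, fun h b m hm ↦ ?_, x, hx,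
      by simp, fun b m hm ↦ h3 (b, m) hm⟩
    · exact (Finset.subset_insert _ _).trans (Finset.subset_insert _ _)
    · exact h2 h (b, m) (by simpa using hm)
  choose next hsub hmem hdist hfix x hxE hxF hxf using step
  let j' : H →+ (B × ℕ → UnitAddCircle) :=
    AddMonoidHom.pi fun a ↦ (Pi.evalAddMonoidHom _ a.1).comp j
  let S : ℕ → State := fun n ↦ Nat.rec (j', ∅) next n
  have hS (n : ℕ) : S (n + 1) = next n (S n) := rfl
  have hmono : Monotone fun n ↦ (S n).2 := monotone_nat_of_le_succ fun n ↦ hsub n (S n)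
  have hbound {h : H} {n : ℕ} (hh : h ∈ (S n).2) (k : ℕ) (a : B × ℕ) :
      dist ((S (n + k)).1 h a) ((S (n + (k + 1))).1 h a) ≤ 1 / 2 ^ n / 2 / 2 ^ k := by
    refine (hdist (n + k) (S (n + k)) h (hmono (Nat.le_add_right n k) hh) a).trans (le_of_eq ?_)
    rw [pow_add]
    field_simp
  have hen' (h : H) : ∃ n, h ∈ (S n).2 := by
    obtain ⟨n, rfl⟩ := hen h
    exact ⟨n + 1, hmem n (S n)⟩
  have hlim (h : H) (a : B × ℕ) : ∃ l, Tendsto (fun n ↦ (S n).1 h a) atTop (𝓝 l) := by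
    obtain ⟨n, hn⟩ := hen' h
    obtain ⟨l, hl⟩ := cauchySeq_tendsto_of_complete
      (cauchySeq_of_le_geometric_two fun k ↦ hbound hn k a)
    refine ⟨l, (tendsto_add_atTop_iff_nat n).1 ?_⟩
    simpa only [add_comm n] using hl
  choose Φ hΦ using hlim
  have hclose {h : H} {n : ℕ} (hh : h ∈ (S n).2) (a : B × ℕ) :
      dist ((S n).1 h a) (Φ h a) ≤ 1 / 2 ^ n := by
    have ht : Tendsto (fun k ↦ (S (n + k)).1 h a) atTop (𝓝 (Φ h a)) := by
      simpa only [add_comm n] using (tendsto_add_atTop_iff_nat n).2 (hΦ h a)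
    simpa using dist_le_of_le_geometric_two_of_tendsto (fun k ↦ hbound hh k a) ht 0
  have hinit (h : H) (b : B) (m : ℕ) : ∀ n ≤ m, (S n).1 h (b, m) = j h b := by
    intro n
    induction n with
    | zero => exact fun _ ↦ rfl
    | succ n ih =>
      intro hn
      rw [hS, hfix n (S n) h b m hn, ih (Nat.le_of_succ_le hn)]
  have hsmall {ε : ℝ} (hε : 0 < ε) (N₀ : ℕ) : ∃ N ≥ N₀, ∀ n ≥ N, (1 : ℝ) / 2 ^ n < ε := by
    obtain ⟨N, hN⟩ := exists_pow_lt_of_lt_one hε (one_half_lt_one (α := ℝ))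
    refine ⟨max N₀ N, le_max_left _ _, fun n hn ↦ ?_⟩
    rw [← one_div_pow]
    exact (pow_le_pow_of_le_one (by norm_num) (by norm_num)
      ((le_max_right _ _).trans hn)).trans_lt hN
  let Ψ : H →+ (B × ℕ → UnitAddCircle) := AddMonoidHom.mk' Φ fun g h ↦ funext fun a ↦
    tendsto_nhds_unique (hΦ (g + h) a) (by simpa using (hΦ g a).add (hΦ h a))
  refine ⟨Ψ, dense_pi_of_forall_finset fun t s ε hε ↦ ?_, fun h b hb ↦ ?_⟩
  -- The error splits as `ε/4` for passing to the limit, `ε/4` for the perturbation and `ε/2` for `f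
  -- n`; `N ≥ s.sup Prod.snd` makes every coordinate in `s` active at stage `n`.
  · obtain ⟨N, hN, hNε⟩ := hsmall (half_pos (half_pos hε)) (s.sup Prod.snd)
    obtain ⟨n, hn, hnt⟩ := hf t s (ε / 2) (half_pos hε) N
    refine ⟨_, ⟨x n (S n), hxE n (S n), rfl⟩, fun ⟨b, m⟩ ha ↦ ?_⟩
    have hm : m ≤ n := (Finset.le_sup (f := Prod.snd) ha).trans (hN.trans hn)
    have h1 := hclose (n := n + 1) (hxF n (S n)) (b, m)
    have h2 := hxf n (S n) b m hm
    have h3 := hnt (b, m) ha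
    have h4 := hNε n hn
    have h5 := hNε (n + 1) (hn.trans n.le_succ)
    have h6 : (1 : ℝ) / 2 / 2 ^ n = 1 / 2 ^ (n + 1) := by rw [pow_succ]; field_simp
    rw [h6] at h2
    rw [dist_comm] at h1
    change dist (Φ (x n (S n)) (b, m)) (t (b, m)) < ε
    have h7 := dist_triangle4 (Φ (x n (S n)) (b, m)) ((S (n + 1)).1 (x n (S n)) (b, m))
      (f n (b, m)) (t (b, m))
    rw [hS] at h7 h1
    linarith
  · obtain ⟨n, hn⟩ := hen' h
    -- At state `m` the coordinate `(b, m)` still equals `j h b`, and later it moves by at most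
    -- `2^-m < ‖j h b‖`.
    obtain ⟨m, hm, hmε⟩ := hsmall (norm_pos_iff.2 hb) n
    refine ⟨m, fun h0 ↦ ?_⟩
    have h1 := hclose (hmono hm hn) (b, m)
    rw [hinit h b m m le_rfl, show Φ h (b, m) = 0 from h0, dist_zero_right] at h1
    exact absurd (hmε m le_rfl) (not_lt.2 h1)

/-! ### Almost torsion sets from dense images -/

theorem UnitAddCircle.finite_nsmul_eq {d : ℕ} (hd : 0 < d) (v : UnitAddCircle) :
    {u : UnitAddCircle | d • u = v}.Finite := by
  rcases Set.eq_empty_or_nonempty {u : UnitAddCircle | d • u = v} with h | ⟨u₀, hu₀⟩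
  · simp [h]
  refine ((AddCircle.finite_torsion (1 : ℝ) hd).preimage
    (f := fun u ↦ u - u₀) sub_left_injective.injOn).subset fun u hu ↦ ?_
  simp only [Set.mem_ofPred_eq] at hu hu₀
  simp [smul_sub, hu, hu₀]

/-- A subset with dense image under some character contains an almost `0`-torsion set. -/
theorem exists_isAlmostTorsion_of_dense {G : Type*} [AddCommGroup G] {S : Set G}
    (χ : G →+ UnitAddCircle) (hχ : Dense (χ '' S)) : ∃ E ⊆ S, IsAlmostTorsion 0 E := by
  classical
  have : Infinite UnitAddCircle := by
    obtain ⟨θ, hθ⟩ := exists_injective_int_addCircle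
    exact Infinite.of_injective θ hθ
  have hex (C : Finset G) (N : ℕ) : ∃ x ∈ S, ∀ c ∈ C, ∀ d, 0 < d → d ≤ N → d • x ≠ d • c := by
    by_contra! hcon
    have hfin : (⋃ c ∈ C, ⋃ d ∈ Finset.Icc 1 N, {u : UnitAddCircle | d • u = d • χ c}).Finite :=
      C.finite_toSet.biUnion fun c _ ↦ (Finset.Icc 1 N).finite_toSet.biUnion fun d hd ↦
        UnitAddCircle.finite_nsmul_eq (Finset.mem_Icc.1 (Finset.mem_coe.1 hd)).1 _
    have hsub : χ '' S ⊆
        ⋃ c ∈ C, ⋃ d ∈ Finset.Icc 1 N, {u : UnitAddCircle | d • u = d • χ c} := by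
      rintro _ ⟨x, hx, rfl⟩
      obtain ⟨c, hc, d, hd, hdN, h⟩ := hcon x hx
      simp only [Set.mem_iUnion]
      refine ⟨c, hc, d, Finset.mem_Icc.2 ⟨hd, hdN⟩, ?_⟩
      rw [Set.mem_ofPred_eq, ← map_nsmul, ← map_nsmul, h]
    have huniv := hfin.isClosed.closure_subset_iff.2 hsub
    rw [hχ.closure_eq] at huniv
    exact Set.infinite_univ (hfin.subset huniv)
  -- Each point carries its bound on `d`. The bounds increase strictly, so the `n`-th is at least
  -- `n` and every `d` is eventually covered.
  obtain ⟨f, hfS, hf⟩ := exists_seq_of_forall_finset_exists (fun q : G × ℕ ↦ q.1 ∈ S)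
    (fun q r ↦ q.2 < r.2 ∧ ∀ d, 0 < d → d ≤ r.2 → d • r.1 ≠ d • q.1) (fun s _ ↦ by
      obtain ⟨x, hx, hxs⟩ := hex (s.image Prod.fst) (s.sup Prod.snd + 1)
      exact ⟨(x, s.sup Prod.snd + 1), hx, fun q hq ↦
        ⟨Nat.lt_succ_of_le (Finset.le_sup (f := Prod.snd) hq),
          hxs _ (Finset.mem_image_of_mem _ hq)⟩⟩)
  have hmono : StrictMono fun n ↦ (f n).2 := fun m n hmn ↦ (hf m n hmn).1
  have hinj : Injective fun n ↦ (f n).1 := by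
    refine .of_lt_imp_ne fun m n hmn h ↦
      (hf m n hmn).2 1 one_pos ((Nat.zero_le _).trans_lt (hf m n hmn).1) ?_
    exact congrArg (1 • ·) h.symm
  refine ⟨Set.range fun n ↦ (f n).1, Set.range_subset_iff.2 hfS, Set.countable_range _,
    Set.infinite_range_of_injective hinj, fun x _ ↦ zero_smul _ x, fun g d hd ↦ ?_⟩
  have hd0 : 0 < d := Nat.pos_of_ne_zero hd.1
  have hfin : {n | d • (f n).1 = g}.Finite := by
    by_contra hinf
    obtain ⟨m, hm⟩ := Set.Infinite.nonempty hinf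
    obtain ⟨n, hn, hlt⟩ := Set.Infinite.exists_gt hinf (max m d)
    exact (hf m n ((le_max_left _ _).trans_lt hlt)).2 d hd0
      (((le_max_right _ _).trans hlt.le).trans (hmono.id_le n)) (hn.trans hm.symm)
  refine (hfin.image fun n ↦ (f n).1).subset ?_
  rintro _ ⟨⟨n, rfl⟩, hn⟩
  exact ⟨n, hn, rfl⟩

/-! ### From a countable subgroup to the whole group -/

/-- Almost `0`-torsion sets lie, as sets with the same properties, in a countable subgroup. -/
theorem IsAlmostTorsion.exists_countable_subgroup {G : Type*} [AddCommGroup G] {E : Set G}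
    (hE : IsAlmostTorsion 0 E) : ∃ H : AddSubgroup G, Countable H ∧ E ⊆ H ∧
      (Subtype.val ⁻¹' E : Set H).Infinite ∧
      ∀ (g : H) (d : ℕ), d ≠ 0 → {x ∈ (Subtype.val ⁻¹' E : Set H) | d • x = g}.Finite := by
  obtain ⟨hc, hinf, -, hfib⟩ := hE
  have : Countable E := hc
  set f : (E →₀ ℤ) →+ G := (Finsupp.linearCombination ℤ (Subtype.val : E → G)).toAddMonoidHom
  have hsub : E ⊆ f.range := fun x hx ↦ ⟨Finsupp.single ⟨x, hx⟩ 1, by simp [f]⟩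
  refine ⟨f.range, (Set.countable_range f).to_subtype, hsub, ?_, fun g d hd ↦ ?_⟩
  · exact hinf.preimage (by rw [Subtype.range_coe]; exact hsub)
  · refine ((hfib g d ⟨hd, hd, dvd_zero d⟩).preimage
      (f := (Subtype.val : f.range → G)) Subtype.val_injective.injOn).subset ?_
    rintro x ⟨hx, rfl⟩
    exact ⟨hx, rfl⟩

theorem exists_reindex {G ι A : Type*} [AddCommGroup G] (e : ι ≃ A) (S : Set G)
    (π : G →+ (A → UnitAddCircle)) :
    ∃ π' : G →+ (ι → UnitAddCircle), (Injective π → Injective π') ∧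
      (Dense (π '' S) → Dense (π' '' S)) := by
  refine ⟨AddMonoidHom.pi fun i ↦ (Pi.evalAddMonoidHom _ (e i)).comp π, fun h ↦ ?_, fun h ↦ ?_⟩
  · exact (e.surjective.injective_comp_right).comp h
  · have hsurj : Surjective fun y : A → UnitAddCircle ↦ y ∘ e := e.injective.surjective_comp_right
    have := hsurj.denseRange.dense_image (by fun_prop) h
    rwa [Set.image_image] at this

/-- If `E` is almost `0`-torsion, some homomorphism to `T ^ ι` has dense image on `E`. -/
theorem IsAlmostTorsion.exists_dense_image {G ι : Type*} [AddCommGroup G] {E : Set G}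
    (hE : IsAlmostTorsion 0 E) (hι : Cardinal.mk ι = Cardinal.continuum) :
    ∃ π : G →+ (ι → UnitAddCircle), Dense (π '' E) := by
  obtain ⟨H, hH, hEH, hinf, hfib⟩ := hE.exists_countable_subgroup
  obtain ⟨e⟩ : Nonempty (ι ≃ ι × ℕ) := Cardinal.eq.1 (by simp [hι])
  obtain ⟨e'⟩ : Nonempty (ι × ℕ ≃ (ℕ → Bool)) := Cardinal.lift_mk_eq'.1 (by simp [hι])
  obtain ⟨Φ, hΦ, -⟩ := exists_hom_dense_image hinf hfib e' e'.injective
    (0 : H →+ (ι → UnitAddCircle))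
  obtain ⟨π, hπ⟩ := exists_extension_pi_addCircle H.subtype Subtype.val_injective Φ
  obtain ⟨π', -, h⟩ := exists_reindex e E π
  refine ⟨π', h (hΦ.mono ?_)⟩
  rintro _ ⟨x, hx, rfl⟩
  exact ⟨x, hx, hπ x⟩

/-- Homomorphisms on two subgroups with trivial intersection have a common extension. -/
theorem exists_common_extension {G A : Type*} [AddCommGroup G] (H K : AddSubgroup G)
    (hHK : ∀ x ∈ H, x ∈ K → x = 0) (f : H →+ (A → UnitAddCircle))
    (g : K →+ (A → UnitAddCircle)) :
    ∃ π : G →+ (A → UnitAddCircle), (∀ x : H, π x = f x) ∧ ∀ x : K, π x = g x := by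
  have hinj : Injective (H.subtype.coprod K.subtype) := by
    rw [injective_iff_map_eq_zero]
    rintro ⟨x, y⟩ hxy
    have hxy' : (x : G) + y = 0 := hxy
    have hx : (x : G) = 0 := hHK x x.2 (by
      rw [eq_neg_of_add_eq_zero_left hxy']
      exact K.neg_mem y.2)
    have hy : (y : G) = 0 := by simpa [hx] using hxy'
    exact Prod.ext (Subtype.ext hx) (Subtype.ext hy)
  obtain ⟨π, hπ⟩ := exists_extension_pi_addCircle _ hinj (f.coprod g)
  exact ⟨π, fun x ↦ by simpa using hπ (x, 0), fun x ↦ by simpa using hπ (0, x)⟩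

/-- An arbitrary extension of `Φ` from `H` may have a kernel. The `Bool` factor therefore splits the
coordinates into two halves. The first half is injective on `H`, so the kernel of any extension `π₁`
meets `H` trivially; an extension `π₂` of the second half can then be required to agree with copies
of `j` on `π₁.ker`, and the two together are injective. -/
theorem IsAlmostTorsion.exists_injective_dense_image {G ι : Type*} [AddCommGroup G] {E : Set G}
    (hE : IsAlmostTorsion 0 E) (hι : Cardinal.mk ι = Cardinal.continuum)
    (hG : Cardinal.mk G ≤ 2 ^ Cardinal.continuum) :
    ∃ π : G →+ (ι → UnitAddCircle), Injective π ∧ Dense (π '' E) := by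
  obtain ⟨H, hH, hEH, hinf, hfib⟩ := hE.exists_countable_subgroup
  have hιinf : Infinite ι := Cardinal.infinite_iff.2 (hι ▸ Cardinal.aleph0_le_continuum)
  obtain ⟨s⟩ : Nonempty (G ↪ Set ι) := Cardinal.lift_mk_le'.1 (by
    rw [Cardinal.mk_set, hι]
    simpa using Cardinal.lift_le.2 hG)
  obtain ⟨j₀, hj₀⟩ := exists_injective_hom_pi s s.injective
  obtain ⟨e₀⟩ : Nonempty (ι ≃ ℕ × (Finset ι × Finset ι)) := Cardinal.eq.1 (by simp [hι])
  obtain ⟨j, hj, -⟩ := exists_reindex e₀ Set.univ j₀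
  replace hj := hj hj₀
  obtain ⟨e⟩ : Nonempty (ι ≃ (ι × Bool) × ℕ) := Cardinal.eq.1 (by simp [hι])
  obtain ⟨e'⟩ : Nonempty ((ι × Bool) × ℕ ≃ (ℕ → Bool)) := Cardinal.lift_mk_eq'.1 (by simp [hι])
  obtain ⟨Φ, hΦ, hΦj⟩ := exists_hom_dense_image hinf hfib e' e'.injective
    (AddMonoidHom.pi fun b : ι × Bool ↦ (Pi.evalAddMonoidHom _ b.1).comp (j.comp H.subtype))
  let half (c : Bool) : H →+ (ι × ℕ → UnitAddCircle) :=
    AddMonoidHom.pi fun a ↦ (Pi.evalAddMonoidHom _ ((a.1, c), a.2)).comp Φ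
  obtain ⟨π₁, hπ₁⟩ := exists_extension_pi_addCircle H.subtype Subtype.val_injective (half false)
  have hker : ∀ x ∈ H, x ∈ π₁.ker → x = 0 := by
    intro x hx hx0
    by_contra hne
    obtain ⟨i, hi⟩ := Function.ne_iff.1 (fun h ↦ hne ((injective_iff_map_eq_zero j).1 hj x h))
    obtain ⟨m, hm⟩ := hΦj ⟨x, hx⟩ (i, false) hi
    apply hm
    change half false ⟨x, hx⟩ (i, m) = 0
    rw [← hπ₁]
    exact congrFun hx0 (i, m)
  obtain ⟨π₂, hπ₂, hπ₂K⟩ := exists_common_extension H π₁.ker hker (half true)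
    (AddMonoidHom.pi fun a : ι × ℕ ↦ (Pi.evalAddMonoidHom _ a.1).comp (j.comp π₁.ker.subtype))
  let π : G →+ ((ι × Bool) × ℕ → UnitAddCircle) := AddMonoidHom.pi fun a ↦
    (Pi.evalAddMonoidHom _ (a.1.1, a.2)).comp (if a.1.2 then π₂ else π₁)
  have hπ (x : H) : π x = Φ x := by
    funext ⟨⟨i, c⟩, m⟩
    cases c
    · exact congrFun (hπ₁ x) (i, m)
    · exact congrFun (hπ₂ x) (i, m)
  have hinjπ : Injective π := by
    rw [injective_iff_map_eq_zero]
    intro x hx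
    have h₁ : x ∈ π₁.ker := funext fun a ↦ congrFun hx ((a.1, false), a.2)
    have h₂ : π₂ x = 0 := funext fun a ↦ congrFun hx ((a.1, true), a.2)
    refine (injective_iff_map_eq_zero j).1 hj x (funext fun i ↦ ?_)
    have := congrFun (hπ₂K ⟨x, h₁⟩) (i, 0)
    rw [h₂] at this
    exact this.symm
  obtain ⟨π', h, h'⟩ := exists_reindex e E π
  refine ⟨π', h hinjπ, h' (hΦ.mono ?_)⟩
  rintro _ ⟨x, hx, rfl⟩
  exact ⟨x, hx, hπ x⟩

theorem mainTheorem3 {G : Type*} [AddCommGroup G] (S : Set G)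
    {ι : Type*} (hι : Cardinal.mk ι = Cardinal.continuum) :
    ((∃ π : G →+ (ι → UnitAddCircle), Dense (π '' S)) ↔
      ∃ E : Set G, E ⊆ S ∧ IsAlmostTorsion 0 E) ∧
    (Cardinal.mk G ≤ 2 ^ Cardinal.continuum →
      ((∃ E : Set G, E ⊆ S ∧ IsAlmostTorsion 0 E) ↔
        ∃ π : G →+ (ι → UnitAddCircle), Function.Injective π ∧ Dense (π '' S))) := by
  have hnec (π : G →+ (ι → UnitAddCircle)) (hπ : Dense (π '' S)) :
      ∃ E : Set G, E ⊆ S ∧ IsAlmostTorsion 0 E := by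
    obtain ⟨i⟩ : Nonempty ι := Cardinal.mk_ne_zero_iff.1 (hι ▸ Cardinal.continuum_ne_zero)
    refine exists_isAlmostTorsion_of_dense ((Pi.evalAddMonoidHom _ i).comp π) ?_
    have := (Function.surjective_eval (β := fun _ : ι ↦ UnitAddCircle) i).denseRange.dense_image
      (continuous_apply i) hπ
    rwa [Set.image_image] at this
  refine ⟨⟨fun ⟨π, hπ⟩ ↦ hnec π hπ, fun ⟨E, hES, hE⟩ ↦ ?_⟩,
    fun hG ↦ ⟨fun ⟨E, hES, hE⟩ ↦ ?_, fun ⟨π, _, hπ⟩ ↦ hnec π hπ⟩⟩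
  · obtain ⟨π, hπ⟩ := hE.exists_dense_image hι
    exact ⟨π, hπ.mono (Set.image_mono hES)⟩
  · obtain ⟨π, hinj, hπ⟩ := hE.exists_injective_dense_image hι hG
    exact ⟨π, hinj, hπ.mono (Set.image_mono hES)⟩
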